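/- **Setting.** Let $N=\{1,\dots,n\}$ be a set of buyers. Buyer $i$ has a valuation $v_i>0$ per unit and a budget $B_i>0$. Let $f:2^N\to\mathbb Z_{+}$ be monotone submodular with $f(\emptyset)=0$ and $f(N)=f(N\setminus\{i\})$ for every $i\in N$. Write $x(S)=\sum_{i\in S}x_i$ and let $$P=\{x\in\mathbb R^N_{+}\mid x(S)\le f(S)\ \ (S\subseteq N)\}.$$ For $x,d\in\mathbb Z_+^N$, $i\in N$ and $w\ge 0$ let $$P_{x,d}=\{u\in\mathbb R^N_+\mid x+u\in P,\ u_j\le d_j\ (j\in N)\},\qquad P^i_{x,d}(w)=\{u|_{N\setminus i}\mid u\in P_{x,d},\ u_i=w\}.$$ **The auction.** The indivisible polyhedral clinching auction (with truthful bids) keeps an allocation $x\in\mathbb Z_+^N$, payments $p\in\mathbb R^N$, demands $d\in\mathbb Z_+^N$ and a price $c$. Initially $x=0$, $p=0$, $d_i=f(\{i\})+1$ for all $i$, and $c=0$. Buyer $i$ is active if $d_i>0$. *Clinching* means: for $i=1,2,\dots,n$ in turn, let $\delta_i$ be the largest nonnegative integer with $P^i_{x,d}(\delta_i)=P^i_{x,d}(0)$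 (for the current $x,d$), and replace $x_i,p_i,d_i$ by $x_i+\delta_i,\ p_i+c\,\delta_i,\ d_i-\delta_i$. While active buyers exist, the auction repeats the following: 1. Increase $c$ until there is an active buyer $j$ with $v_j=c$ or $d_j=(B_j-p_j)/c$. 2. While there is an active buyer $j$ with $v_j=c$: pick any such $j$, set $d_j:=0$, and perform clinching. 3. While there is an active buyer $j$ with $d_j=(B_j-p_j)/c$: pick any such $j$, set $d_j:=d_j-1$, and perform clinching. When no buyer is active, it outputs $(x^{\rm f},p^{\rm f}):=(x,p)$. **Theorem.** The auction terminates, whichever buyers are picked. For every possible output $(x^{\rm f},p^{\rm f})$ put $${\rm LW}^{\rm M}=\sum_{i\in N}\min(v_ix^{\rm f}_i,B_i),\qquad {\rm LW}^{\rm OPT}=\max\Bigl\{\sum_{i\in N}\min(v_ix_i,B_i)\ \Big|\ x\in P\cap\mathbb Z^N\Bigr\}.$$ Then $${\rm LW}^{\rm M}\ \ge\ p^{\rm f}(N)\ \ge\ {\rm LW}^{\rm OPT}-{\rm LW}^{\rm M},$$ and consequently ${\rm LW}^{\rm M}\ge\frac12\,{\rm LW}^{\rm OPT}$. -/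

import Mathlib

namespace ClinchingAuction

/-- An integer-valued monotone submodular set function on the set of buyers. -/
structure IsMonotoneSubmodular {n : ℕ} (f : Finset (Fin n) → ℕ) : Prop where
  empty : f ∅ = 0
  mono : ∀ S T : Finset (Fin n), S ⊆ T → f S ≤ f T
  /-- Diminishing returns: `f (T ∪ e) - f T ≤ f (S ∪ e) - f S`, written without subtraction. -/
  submod : ∀ (S T : Finset (Fin n)) (e : Fin n), S ⊆ T → e ∉ T →
    f (insert e T) + f S ≤ f (insert e S) + f T

/-- The polymatroid `P(f)` of nonnegative real vectors `x` with `x(S) ≤ f(S)` for all `S`. -/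
def polymatroid {n : ℕ} (f : Finset (Fin n) → ℕ) : Set (Fin n → ℝ) :=
  {x | (∀ i, 0 ≤ x i) ∧ ∀ S : Finset (Fin n), ∑ i ∈ S, x i ≤ (f S : ℝ)}

/-- The remnant supply polytope `P_{x,d}`. -/
def remnantSupply {n : ℕ} (f : Finset (Fin n) → ℕ) (x d : Fin n → ℝ) : Set (Fin n → ℝ) :=
  {u | (∀ i, 0 ≤ u i) ∧ x + u ∈ polymatroid f ∧ ∀ i, u i ≤ d i}

/-- The polytope `P^i_{x,d}(w)`: the restrictions to the buyers other than `i` of the vectors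
`u ∈ P_{x,d}` with `u i = w`. -/
def othersSupply {n : ℕ} (f : Finset (Fin n) → ℕ) (x d : Fin n → ℝ) (i : Fin n) (w : ℝ) :
    Set ({j : Fin n // j ≠ i} → ℝ) :=
  (fun (u : Fin n → ℝ) (j : {j : Fin n // j ≠ i}) => u j) '' {u | u ∈ remnantSupply f x d ∧ u i = w}

open scoped Classical in
/-- The clinching amount of buyer `i`: the largest nonnegative integer `w` (necessarily at most the
demand `d i`) such that `P^i_{x,d}(w) = P^i_{x,d}(0)`. -/
noncomputable def clinchAmount {n : ℕ} (f : Finset (Fin n) → ℕ) (x d : Fin n → ℕ) (i : Fin n) : ℕ :=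
  Nat.findGreatest
    (fun w : ℕ => othersSupply f (fun j => (x j : ℝ)) (fun j => (d j : ℝ)) i (w : ℝ) =
      othersSupply f (fun j => (x j : ℝ)) (fun j => (d j : ℝ)) i 0)
    (d i)

/-- Allocation `x`, payments `p` and demands `d` during the auction. -/
structure Market (n : ℕ) where
  x : Fin n → ℕ
  p : Fin n → ℝ
  d : Fin n → ℕ

/-- Buyer `i` clinches at the price `c`. -/
noncomputable def clinchBuyer {n : ℕ} (f : Finset (Fin n) → ℕ) (c : ℝ) (m : Market n) (i : Fin n) :
    Market n where
  x := Function.update m.x i (m.x i + clinchAmount f m.x m.d i)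
  p := Function.update m.p i (m.p i + c * (clinchAmount f m.x m.d i : ℝ))
  d := Function.update m.d i (m.d i - clinchAmount f m.x m.d i)

/-- The clinching subroutine: the buyers clinch one after the other, in increasing order. -/
noncomputable def clinching {n : ℕ} (f : Finset (Fin n) → ℕ) (c : ℝ) (m : Market n) : Market n :=
  (List.finRange n).foldl (clinchBuyer f c) m

/-- Where the auction stands: at the head of the outer loop (`outer`), in the inner loop that
handles buyers whose bid equals the price (`bids`), or in the inner loop that handles buyers whose
demand equals remaining budget over price (`budgets`). -/
inductive Phase where
  | outer
  | bids
  | budgets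

/-- A state of the auction: the market, the price clock `c` and the phase. -/
structure State (n : ℕ) extends Market n where
  c : ℝ
  phase : Phase

/-- Buyer `i` is active. -/
def Market.Active {n : ℕ} (m : Market n) (i : Fin n) : Prop := 0 < m.d i

/-- The demand of buyer `j` becomes `k`. -/
def Market.setDemand {n : ℕ} (m : Market n) (j : Fin n) (k : ℕ) : Market n where
  x := m.x
  p := m.p
  d := Function.update m.d j k

/-- The prices `t` at which some active buyer `j` has bid `t`, or demand exactly equal to
remaining budget divided by `t`. (An active buyer has `d j ≠ 0`, so the convention `a / 0 = 0`
contributes nothing.) -/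
def criticalPrices {n : ℕ} (bid B : Fin n → ℝ) (m : Market n) : Set ℝ :=
  {t | ∃ j, m.Active j ∧ (bid j = t ∨ (m.d j : ℝ) = (B j - m.p j) / t)}

/-- The initial state. -/
def initial {n : ℕ} (f : Finset (Fin n) → ℕ) : State n where
  x := fun _ => 0
  p := fun _ => 0
  d := fun i => f {i} + 1
  c := 0
  phase := Phase.outer

/-- One step of the polyhedral clinching auction for indivisible goods with reported bids `bid`
and budgets `B`. The steps are nondeterministic: whenever the auction picks a buyer with a certain
property, any such buyer may be picked. -/
inductive Step {n : ℕ} (f : Finset (Fin n) → ℕ) (bid B : Fin n → ℝ) : State n → State n → Prop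
  /-- If active buyers exist, the price increases to the next critical price. -/
  | raisePrice (m : Market n) (c t : ℝ) (hact : ∃ i, m.Active i)
      (ht : IsLeast {t : ℝ | c ≤ t ∧ t ∈ criticalPrices bid B m} t) :
      Step f bid B ⟨m, c, Phase.outer⟩ ⟨m, t, Phase.bids⟩
  /-- An active buyer whose bid equals the price gets demand zero; then the buyers clinch. -/
  | dropBid (m : Market n) (c : ℝ) (j : Fin n) (hact : m.Active j) (hj : bid j = c) :
      Step f bid B ⟨m, c, Phase.bids⟩ ⟨clinching f c (m.setDemand j 0), c, Phase.bids⟩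
  | endBids (m : Market n) (c : ℝ) (hno : ¬ ∃ j, m.Active j ∧ bid j = c) :
      Step f bid B ⟨m, c, Phase.bids⟩ ⟨m, c, Phase.budgets⟩
  /-- An active buyer whose demand equals remaining budget over price reduces the demand by one;
  then the buyers clinch. -/
  | reduceDemand (m : Market n) (c : ℝ) (j : Fin n) (hact : m.Active j)
      (hj : (m.d j : ℝ) = (B j - m.p j) / c) :
      Step f bid B ⟨m, c, Phase.budgets⟩
        ⟨clinching f c (m.setDemand j (m.d j - 1)), c, Phase.budgets⟩
  | endBudgets (m : Market n) (c : ℝ)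
      (hno : ¬ ∃ j, m.Active j ∧ (m.d j : ℝ) = (B j - m.p j) / c) :
      Step f bid B ⟨m, c, Phase.budgets⟩ ⟨m, c, Phase.outer⟩

/-- The states that occur in some execution of the auction. -/
def Reachable {n : ℕ} (f : Finset (Fin n) → ℕ) (bid B : Fin n → ℝ) (s : State n) : Prop :=
  Relation.ReflTransGen (Step f bid B) (initial f) s

/-- The auction is over: the outer loop is left because no buyer is active. -/
def State.Final {n : ℕ} (s : State n) : Prop :=
  s.phase = Phase.outer ∧ ∀ i, ¬ s.Active i

/-- The auction terminates whatever buyers are picked: there is no infinite execution, and an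
execution that cannot be continued has reached a final state. -/
def Terminates {n : ℕ} (f : Finset (Fin n) → ℕ) (bid B : Fin n → ℝ) : Prop :=
  (¬ ∃ run : ℕ → State n, run 0 = initial f ∧ ∀ k, Step f bid B (run k) (run (k + 1))) ∧
  ∀ s, Reachable f bid B s → (∀ s', ¬ Step f bid B s s') → s.Final

/-- `(x, p)` is a possible output (allocation, payments) of the auction. -/
def IsOutcome {n : ℕ} (f : Finset (Fin n) → ℕ) (bid B : Fin n → ℝ)
    (x : Fin n → ℕ) (p : Fin n → ℝ) : Prop :=
  ∃ s, Reachable f bid B s ∧ s.Final ∧ s.x = x ∧ s.p = p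

/-- The liquid welfare of an allocation. -/
def liquidWelfare {n : ℕ} (v B : Fin n → ℝ) (x : Fin n → ℕ) : ℝ :=
  ∑ i, min (v i * (x i : ℝ)) (B i)

/-- The integer points of the polymatroid. -/
def integerPoints {n : ℕ} (f : Finset (Fin n) → ℕ) : Set (Fin n → ℕ) :=
  {x | (fun i => (x i : ℝ)) ∈ polymatroid f}

/-- The optimal liquid welfare over the integer points of the polymatroid. -/
noncomputable def optLiquidWelfare {n : ℕ} (f : Finset (Fin n) → ℕ) (v B : Fin n → ℝ) : ℝ :=
  sSup (liquidWelfare v B '' integerPoints f)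

/-- The optimum is attained, so that the supremum above is a maximum. -/
theorem isGreatest_optLiquidWelfare {n : ℕ} (f : Finset (Fin n) → ℕ) (v B : Fin n → ℝ) :
    IsGreatest (liquidWelfare v B '' integerPoints f) (optLiquidWelfare f v B) := by
  have hfin : (integerPoints f).Finite := by
    apply (Set.finite_Iic (fun i : Fin n => f {i})).subset
    intro x hx i
    have h := hx.2 {i}
    simp only [Finset.sum_singleton] at h
    exact_mod_cast h
  have hne : (integerPoints f).Nonempty :=
    ⟨fun _ => 0, fun i => by simp, fun S => by simp⟩
  have hfin' := hfin.image (liquidWelfare v B)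
  exact ⟨(hne.image _).csSup_mem hfin', fun y hy => le_csSup hfin'.bddAbove hy⟩

end ClinchingAuction

namespace ClinchingAuction

variable {n : ℕ} {f : Finset (Fin n) → ℕ}

/-! No buyer pays more than value or budget, so the payments are at most the liquid welfare of the
output. For the other inequality, compare the final allocation `x` with an optimal `y`, and let `z`
be the positive part of `y - x`. While the price rises, credit buyer `i` with `min (z i) (d i)` per
unit of price.

The credits are covered by `p(N) + c (f(N) - x(N))`. A purchase at price `c` leaves this quantity
unchanged, and a price rise increases it at least as fast as the credits, by `sum_min_le_supply`.
That lemma rests on a formula for clinching: a buyer clinches the amount, if positive, by which the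
demand exceeds the least `excess` of a set avoiding the buyer. So each buyer who has clinched lies
outside a set of small excess, and such sets can be intersected. At the end everything is sold, and
the credits total at most `p(N)`.

Each final credit is at least `min (v z) (B - p)`, hence at least the gain from `x` to `y`
(`GainBound`). If the demand stays at least `z` until the price reaches `v`, the credit is `v z`.
Otherwise the budget has limited the demand, and when it first falls below `z` the credit already
covers the remaining budget. -/

/-! ### Submodularity and excess -/

theorem IsMonotoneSubmodular.union_add_le (hf : IsMonotoneSubmodular f)
    {S T : Finset (Fin n)} (hST : S ⊆ T) (U : Finset (Fin n)) :
    f (T ∪ U) + f S ≤ f (S ∪ U) + f T := by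
  induction U using Finset.induction_on with
  | empty => simp [add_comm]
  | insert e U _ ih =>
    rw [Finset.union_insert, Finset.union_insert]
    by_cases he : e ∈ T ∪ U
    · rw [Finset.insert_eq_of_mem he]
      have := hf.mono _ _ (Finset.subset_insert e (S ∪ U))
      omega
    · have := hf.submod (S ∪ U) (T ∪ U) e (Finset.union_subset_union_left hST) he
      omega

theorem IsMonotoneSubmodular.union_add_inter_le (hf : IsMonotoneSubmodular f)
    (S T : Finset (Fin n)) : f (S ∪ T) + f (S ∩ T) ≤ f S + f T := by
  have h := hf.union_add_le (S := S ∩ T) (T := T) Finset.inter_subset_right S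
  rwa [Finset.union_comm T S, Finset.union_eq_right.2 Finset.inter_subset_left] at h

theorem IsMonotoneSubmodular.union_le_add_sum (hf : IsMonotoneSubmodular f)
    (S U : Finset (Fin n)) : f (S ∪ U) ≤ f S + ∑ i ∈ U, f {i} := by
  induction U using Finset.induction_on with
  | empty => simp
  | insert e U he ih =>
    have h := hf.union_add_inter_le (S ∪ U) {e}
    have h' : S ∪ insert e U = S ∪ U ∪ {e} := by
      ext
      simp only [Finset.mem_union, Finset.mem_insert, Finset.mem_singleton]
      tauto
    rw [Finset.sum_insert he, h']
    omega

/-- The amount by which the supply bound `f S`, together with the total demand `q` of the buyers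
outside `S`, exceeds the whole supply. -/
def excess (f : Finset (Fin n) → ℕ) (q : Fin n → ℕ) (S : Finset (Fin n)) : ℤ :=
  f S + ∑ i ∈ Sᶜ, (q i : ℤ) - f Finset.univ

theorem excess_univ (q : Fin n → ℕ) : excess f q Finset.univ = 0 := by
  simp [excess]

theorem sum_compl_union_add_inter (q : Fin n → ℤ) (S T : Finset (Fin n)) :
    ∑ i ∈ (S ∪ T)ᶜ, q i + ∑ i ∈ (S ∩ T)ᶜ, q i = ∑ i ∈ Sᶜ, q i + ∑ i ∈ Tᶜ, q i := by
  rw [Finset.compl_union, Finset.compl_inter, add_comm, Finset.sum_union_inter]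

theorem IsMonotoneSubmodular.excess_union_add_inter_le (hf : IsMonotoneSubmodular f)
    (q : Fin n → ℕ) (S T : Finset (Fin n)) :
    excess f q (S ∪ T) + excess f q (S ∩ T) ≤ excess f q S + excess f q T := by
  have h := hf.union_add_inter_le S T
  have h' := sum_compl_union_add_inter (fun i => (q i : ℤ)) S T
  simp only [excess]
  omega

theorem excess_nonneg {q d : Fin n → ℕ}
    (h : ∀ i S, i ∉ S → (d i : ℤ) ≤ excess f q S) (S : Finset (Fin n)) : 0 ≤ excess f q S := by
  by_cases hS : S = Finset.univ
  · rw [hS, excess_univ]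
  · obtain ⟨i, hi⟩ : ∃ i, i ∉ S := by
      by_contra! hall
      exact hS (Finset.eq_univ_iff_forall.2 hall)
    exact (Int.natCast_nonneg _).trans (h i S hi)

/-- Lowering the demand of `j` lowers the excess of the sets that avoid `j`. -/
theorem excess_update_of_notMem (x d : Fin n → ℕ) {j : Fin n} {k : ℕ}
    {S : Finset (Fin n)} (hj : j ∉ S) :
    excess f (x + Function.update d j k) S = excess f (x + d) S - d j + k := by
  have hj' : j ∈ Sᶜ := by simpa using hj
  simp only [excess, Pi.add_apply, Nat.cast_add, Finset.sum_add_distrib]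
  have h1 := Finset.add_sum_erase Sᶜ (fun i => (d i : ℤ)) hj'
  have h2 := Finset.add_sum_erase Sᶜ (fun i => ((Function.update d j k i : ℕ) : ℤ)) hj'
  have h3 : ∑ i ∈ Sᶜ.erase j, ((Function.update d j k i : ℕ) : ℤ) =
      ∑ i ∈ Sᶜ.erase j, (d i : ℤ) :=
    Finset.sum_congr rfl fun i hi => by
      rw [Function.update_of_ne (Finset.ne_of_mem_erase hi)]
  simp only [Function.update_self] at h2
  omega

theorem excess_update_of_mem (x d : Fin n → ℕ) {j : Fin n} {k : ℕ}
    {S : Finset (Fin n)} (hj : j ∈ S) :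
    excess f (x + Function.update d j k) S = excess f (x + d) S := by
  simp only [excess]
  congr 2
  refine Finset.sum_congr rfl fun i hi => ?_
  have : i ≠ j := by
    rintro rfl
    simp [hj] at hi
  simp [Function.update_of_ne this]

/-! ### Clinching amounts in terms of excess -/

theorem mem_remnantSupply_of_le {x d u u' : Fin n → ℝ} (hx : ∀ i, 0 ≤ x i)
    (h : u' ∈ remnantSupply f x d) (h0 : ∀ i, 0 ≤ u i) (hle : ∀ i, u i ≤ u' i) :
    u ∈ remnantSupply f x d :=
  ⟨h0, ⟨fun i => add_nonneg (hx i) (h0 i), fun S =>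
    (Finset.sum_le_sum fun i _ => add_le_add le_rfl (hle i)).trans (h.2.1.2 S)⟩,
    fun i => (hle i).trans (h.2.2 i)⟩

/-- The remnant supply is closed downwards, so lowering coordinate `i` to zero gives one inclusion
for free; only raising it from zero to `w` is a condition. -/
theorem othersSupply_eq_iff {x d : Fin n → ℝ} (hx : ∀ i, 0 ≤ x i) {i : Fin n} {w : ℝ} :
    othersSupply f x d i w = othersSupply f x d i 0 ↔
      ∀ u ∈ remnantSupply f x d, u i = 0 → Function.update u i w ∈ remnantSupply f x d := by
  constructor
  · intro h u hu hi
    have hmem : (fun j : {j : Fin n // j ≠ i} => u j) ∈ othersSupply f x d i w := by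
      rw [h]
      exact ⟨u, ⟨hu, hi⟩, rfl⟩
    obtain ⟨u', ⟨hu', hw'⟩, heq⟩ := hmem
    have : Function.update u i w = u' := by
      funext j
      by_cases hj : j = i
      · subst hj
        simp [hw']
      · rw [Function.update_of_ne hj]
        exact (congrFun heq ⟨j, hj⟩).symm
    rwa [this]
  · intro h
    apply Set.Subset.antisymm
    · rintro _ ⟨u, ⟨hu, hi⟩, rfl⟩
      refine ⟨Function.update u i 0, ⟨mem_remnantSupply_of_le hx hu ?_ ?_, by simp⟩, ?_⟩
      · intro j
        by_cases hj : j = i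
        · subst hj
          simp
        · rw [Function.update_of_ne hj]
          exact hu.1 j
      · intro j
        by_cases hj : j = i
        · subst hj
          simpa using hu.1 j
        · rw [Function.update_of_ne hj]
      · funext j
        exact Function.update_of_ne j.2 _ _
    · rintro _ ⟨u, ⟨hu, hi⟩, rfl⟩
      refine ⟨Function.update u i w, ⟨h u hu hi, by simp⟩, ?_⟩
      funext j
      exact Function.update_of_ne j.2 _ _

theorem clinchAmount_le (x d : Fin n → ℕ) (i : Fin n) : clinchAmount f x d i ≤ d i :=
  Nat.findGreatest_le _

theorem clinchAmount_spec (x d : Fin n → ℕ) (i : Fin n) :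
    othersSupply f (fun j => (x j : ℝ)) (fun j => (d j : ℝ)) i (clinchAmount f x d i : ℝ) =
      othersSupply f (fun j => (x j : ℝ)) (fun j => (d j : ℝ)) i 0 := by
  classical
  unfold clinchAmount
  exact Nat.findGreatest_spec (P := fun w : ℕ =>
    othersSupply f (fun j => (x j : ℝ)) (fun j => (d j : ℝ)) i (w : ℝ) =
      othersSupply f (fun j => (x j : ℝ)) (fun j => (d j : ℝ)) i 0) (Nat.zero_le (d i)) (by simp)

theorem update_clinchAmount_mem {x d : Fin n → ℕ} {i : Fin n} {u : Fin n → ℝ}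
    (hu : u ∈ remnantSupply f (fun j => (x j : ℝ)) (fun j => (d j : ℝ))) (hi : u i = 0) :
    Function.update u i (clinchAmount f x d i : ℝ) ∈
      remnantSupply f (fun j => (x j : ℝ)) (fun j => (d j : ℝ)) :=
  (othersSupply_eq_iff fun _ => Nat.cast_nonneg _).1
    (clinchAmount_spec x d i) u hu hi

/-- For `S` containing `i`, bound the use of `S ∩ T` by `f (S ∩ T)` and that of `S \ T` by full
demands, where the unused `d i` makes room for `w`. Submodularity and the nonnegative excess of `S ∪
T` turn this into `f S`. -/
theorem le_clinchAmount (hf : IsMonotoneSubmodular f) {x d : Fin n → ℕ} {i : Fin n}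
    (h0 : ∀ S, 0 ≤ excess f (x + d) S) {T : Finset (Fin n)} (hiT : i ∉ T) {w : ℕ}
    (hw : (w : ℤ) + excess f (x + d) T ≤ d i) : w ≤ clinchAmount f x d i := by
  classical
  have hwd : w ≤ d i := by
    have := h0 T
    omega
  unfold clinchAmount
  refine Nat.le_findGreatest hwd ?_
  rw [othersSupply_eq_iff fun _ => Nat.cast_nonneg _]
  intro u hu hi
  have hnonneg : ∀ j, 0 ≤ Function.update u i (w : ℝ) j := by
    intro j
    by_cases hj : j = i
    · subst hj
      simp
    · rw [Function.update_of_ne hj]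
      exact hu.1 j
  refine ⟨hnonneg, ⟨fun j => add_nonneg (Nat.cast_nonneg _) (hnonneg j), fun S => ?_⟩, fun j => ?_⟩
  · by_cases hiS : i ∈ S
    · have hsub := hf.union_add_inter_le S T
      have hST := h0 (S ∪ T)
      have hi' : i ∈ S \ T := by simp [hiS, hiT]
      have hsplit : ∑ j ∈ Tᶜ, ((x + d) j : ℤ) =
          ∑ j ∈ (S ∪ T)ᶜ, ((x + d) j : ℤ) + ∑ j ∈ S \ T, ((x + d) j : ℤ) := by
        rw [← Finset.sum_union]
        · congr 1
          ext j
          simp only [Finset.mem_compl, Finset.mem_union, Finset.mem_sdiff]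
          tauto
        · rw [Finset.disjoint_left]
          intro j
          simp only [Finset.mem_compl, Finset.mem_union, Finset.mem_sdiff]
          tauto
      have key : (w : ℤ) + f (S ∩ T) + ∑ j ∈ S \ T, ((x + d) j : ℤ) ≤ f S + d i := by
        simp only [excess] at hw hST
        omega
      have key' : (w : ℝ) + f (S ∩ T) + ∑ j ∈ S \ T, ((x j : ℝ) + d j) ≤ f S + d i := by
        simp only [Pi.add_apply] at key
        exact_mod_cast key
      have hint := hu.2.1.2 (S ∩ T)
      have hrest : ∑ j ∈ (S \ T).erase i, u j ≤ ∑ j ∈ (S \ T).erase i, (d j : ℝ) :=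
        Finset.sum_le_sum fun j _ => hu.2.2 j
      have e1 := Finset.add_sum_erase (S \ T) (fun j => (d j : ℝ)) hi'
      have e2 := Finset.add_sum_erase (S \ T) (fun j => u j) hi'
      have e3 := Finset.sum_inter_add_sum_sdiff S T (fun j => (x j : ℝ))
      have e4 := Finset.sum_inter_add_sum_sdiff S T (fun j => u j)
      have e5 := Finset.sum_update_of_mem hiS u (w : ℝ)
      have e6 := Finset.add_sum_erase S (fun j => u j) hiS
      rw [Finset.sdiff_singleton_eq_erase] at e5
      simp only [Pi.add_apply, Finset.sum_add_distrib] at hint key' ⊢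
      linarith
    · refine le_trans (le_of_eq (Finset.sum_congr rfl fun j hj => ?_)) (hu.2.1.2 S)
      have : j ≠ i := by
        rintro rfl
        exact hiS hj
      simp [Function.update_of_ne this]
  · by_cases hj : j = i
    · subst hj
      simpa using hwd
    · rw [Function.update_of_ne hj]
      exact hu.2.2 j

theorem natCast_mem_remnantSupply {x d u : Fin n → ℕ} (hd : ∀ i, u i ≤ d i)
    (hu : ∀ S, ∑ i ∈ S, (x i + u i) ≤ f S) :
    (fun j => (u j : ℝ)) ∈ remnantSupply f (fun j => (x j : ℝ)) (fun j => (d j : ℝ)) := by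
  refine ⟨fun i => Nat.cast_nonneg _, ⟨fun i => add_nonneg (Nat.cast_nonneg _) (Nat.cast_nonneg _), fun S => ?_⟩,
    fun i => Nat.cast_le.2 (hd i)⟩
  simp only [Pi.add_apply]
  exact_mod_cast hu S

theorem sum_add_single_clinchAmount_le {x d u : Fin n → ℕ} {i : Fin n} (hd : ∀ i, u i ≤ d i)
    (hu : ∀ S, ∑ i ∈ S, (x i + u i) ≤ f S) (hi : u i = 0) (S : Finset (Fin n)) :
    ∑ j ∈ S, (x j + u j) + (if i ∈ S then clinchAmount f x d i else 0) ≤ f S := by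
  have h := (update_clinchAmount_mem (natCast_mem_remnantSupply hd hu) (i := i)
    (by simp [hi])).2.1.2 S
  split_ifs with hiS
  · have e5 := Finset.sum_update_of_mem hiS (fun j => (u j : ℝ)) (clinchAmount f x d i : ℝ)
    have e6 := Finset.add_sum_erase S (fun j => (u j : ℝ)) hiS
    rw [Finset.sdiff_singleton_eq_erase] at e5
    simp only [Pi.add_apply, Finset.sum_add_distrib] at h
    simp only [hi, Nat.cast_zero, zero_add] at e6
    rw [e5, e6] at h
    rw [Finset.sum_add_distrib]
    have h' : (∑ j ∈ S, (x j : ℝ)) + ∑ j ∈ S, (u j : ℝ) + (clinchAmount f x d i : ℝ) ≤ f S := by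
      linarith
    exact_mod_cast h'
  · exact hu S

/-- Give the other buyers a maximal integral `u`, and let `T` be the union of all tight sets, again
tight by submodularity. Room for clinching keeps `i` out of `T`, and maximality saturates every
other demand outside `T`. Adding the clinching amount to `u` and counting over all buyers yields the
bound. -/
theorem exists_excess_add_clinchAmount_le (hf : IsMonotoneSubmodular f) {x d : Fin n → ℕ}
    (hx : ∀ S, ∑ i ∈ S, x i ≤ f S) {i : Fin n} (hpos : 0 < clinchAmount f x d i) :
    ∃ T, i ∉ T ∧ excess f (x + d) T + clinchAmount f x d i ≤ d i := by
  classical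
  obtain ⟨u, hu⟩ : ∃ u, Maximal (fun u : Fin n → ℕ =>
      u i = 0 ∧ (∀ j, u j ≤ d j) ∧ ∀ S, ∑ j ∈ S, (x j + u j) ≤ f S) u := by
    refine Set.Finite.exists_maximal (s := {u : Fin n → ℕ | u i = 0 ∧ (∀ j, u j ≤ d j) ∧
      ∀ S, ∑ j ∈ S, (x j + u j) ≤ f S}) ?_ ⟨0, by simpa using hx⟩
    exact (Set.finite_Iic d).subset fun u hu => hu.2.1
  obtain ⟨hui, hud, huS⟩ := hu.prop
  let T : Finset (Fin n) :=
    (Finset.univ.filter fun S => ∑ j ∈ S, (x j + u j) = f S).sup id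
  have hT : ∑ j ∈ T, (x j + u j) = f T := by
    refine Finset.sup_induction (p := fun S => ∑ j ∈ S, (x j + u j) = f S) ?_ ?_ ?_
    · simp [hf.empty]
    · intro S hS S' hS'
      have h1 := hf.union_add_inter_le S S'
      have h2 := huS (S ∪ S')
      have h3 := huS (S ∩ S')
      have h4 := Finset.sum_union_inter (s₁ := S) (s₂ := S') (f := fun j => x j + u j)
      simp only [Finset.sup_eq_union]
      omega
    · intro S hS
      exact (Finset.mem_filter.1 hS).2
  have hiT : i ∉ T := by
    intro hiT
    have := sum_add_single_clinchAmount_le hud huS hui T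
    rw [if_pos hiT] at this
    omega
  have hout : ∀ j, j ∉ T → j ≠ i → u j = d j := by
    intro j hjT hji
    by_contra hne
    have hlt : u j < d j := lt_of_le_of_ne (hud j) hne
    have hnot : ¬ ∀ S, ∑ k ∈ S, (x k + Function.update u j (u j + 1) k) ≤ f S := by
      intro hall
      have := hu.le_of_ge (y := Function.update u j (u j + 1))
        ⟨by rw [Function.update_of_ne (Ne.symm hji)]; exact hui, fun k => ?_, hall⟩ ?_ j
      · simp at this
      · by_cases hk : k = j
        · subst hk
          simpa using hlt
        · rw [Function.update_of_ne hk]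
          exact hud k
      · intro k
        by_cases hk : k = j
        · subst hk
          simp
        · rw [Function.update_of_ne hk]
    push Not at hnot
    obtain ⟨S, hS⟩ := hnot
    have hSle := huS S
    by_cases hjS : j ∈ S
    · have e5 := Finset.sum_update_of_mem hjS u (u j + 1)
      have e6 := Finset.add_sum_erase S u hjS
      rw [Finset.sdiff_singleton_eq_erase] at e5
      rw [Finset.sum_add_distrib] at hS hSle
      have htight : ∑ j ∈ S, (x j + u j) = f S := by
        rw [Finset.sum_add_distrib]
        omega
      exact hjT (Finset.mem_of_subset
        (Finset.le_sup (f := id) (Finset.mem_filter.2 ⟨Finset.mem_univ S, htight⟩)) hjS)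
    · refine absurd hS (not_lt.2 (le_trans (le_of_eq (Finset.sum_congr rfl fun k hk => ?_)) hSle))
      have : k ≠ j := by
        rintro rfl
        exact hjS hk
      rw [Function.update_of_ne this]
  refine ⟨T, hiT, ?_⟩
  have hiT' : i ∈ Tᶜ := by simpa using hiT
  have hN := sum_add_single_clinchAmount_le hud huS hui Finset.univ
  rw [if_pos (Finset.mem_univ i), ← Finset.sum_add_sum_compl T, hT] at hN
  have e1 := Finset.add_sum_erase Tᶜ (fun j => x j + d j) hiT'
  have e2 := Finset.add_sum_erase Tᶜ (fun j => x j + u j) hiT'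
  have e3 : ∑ j ∈ Tᶜ.erase i, (x j + u j) = ∑ j ∈ Tᶜ.erase i, (x j + d j) :=
    Finset.sum_congr rfl fun j hj => by
      rw [hout j (by simpa using Finset.mem_of_mem_erase hj) (Finset.ne_of_mem_erase hj)]
  have e4 : ∑ j ∈ Tᶜ, ((x + d) j : ℤ) = ((∑ j ∈ Tᶜ, (x j + d j) : ℕ) : ℤ) := by
    push_cast [Pi.add_apply]
    rfl
  simp only [excess]
  rw [e4]
  omega

/-! ### The supply available for further units -/

/-- The buyers with positive allocation outside the support of `z` have been confined by sets of
small excess; intersecting these sets bounds the goods that the support of `z` can still use. -/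
theorem sum_min_le_supply (hf : IsMonotoneSubmodular f) {x d y z : Fin n → ℕ}
    (h0 : ∀ S, 0 ≤ excess f (x + d) S)
    (htight : ∀ i, x i = 0 ∨ ∃ S, i ∉ S ∧ excess f (x + d) S ≤ d i)
    (hy : ∀ S, ∑ i ∈ S, y i ≤ f S) (hz : ∀ i, z i = 0 ∨ x i + z i ≤ y i) :
    ∑ i, min (z i) (d i) + ∑ i, x i ≤ f Finset.univ := by
  classical
  -- Since unions have nonnegative excess, submodularity bounds the excess of an intersection by the
  -- sum of the excesses.
  have hinter : ∀ W : Finset (Fin n), (∀ i ∈ W, x i ≠ 0) →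
      ∃ S, Disjoint S W ∧ excess f (x + d) S ≤ ∑ i ∈ W, (d i : ℤ) := by
    intro W
    induction W using Finset.induction_on with
    | empty => exact fun _ => ⟨Finset.univ, by simp, by simp [excess_univ]⟩
    | insert j W hj ih =>
      intro hW
      obtain ⟨S, hS, hSe⟩ := ih fun i hi => hW i (Finset.mem_insert_of_mem hi)
      obtain ⟨T, hjT, hTe⟩ := (htight j).resolve_left (hW j (Finset.mem_insert_self j W))
      refine ⟨S ∩ T, ?_, ?_⟩
      · rw [Finset.disjoint_insert_right]
        exact ⟨fun h => hjT (Finset.mem_inter.1 h).2,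
          hS.mono_left Finset.inter_subset_left⟩
      · rw [Finset.sum_insert hj]
        have h1 := hf.excess_union_add_inter_le (x + d) S T
        have h2 := h0 (S ∪ T)
        omega
  set X : Finset (Fin n) := Finset.univ.filter fun i => z i ≠ 0 with hX
  set W : Finset (Fin n) := Finset.univ.filter fun i => z i = 0 ∧ x i ≠ 0 with hW
  obtain ⟨S, hSW, hSe⟩ := hinter W fun i hi => (Finset.mem_filter.1 hi).2.2
  have hWS : W ⊆ Sᶜ := fun i hi => by
    rw [Finset.mem_compl]
    exact fun h => Finset.disjoint_left.1 hSW h hi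
  have hXin : ∑ i ∈ S, min (z i) (d i) + ∑ i ∈ S, x i ≤ f S := by
    rw [← Finset.sum_add_distrib]
    refine le_trans ?_ (hy S)
    refine Finset.sum_le_sum fun i hi => ?_
    rcases hz i with hzi | hzi
    · have : x i = 0 := by
        by_contra hxi
        exact Finset.disjoint_left.1 hSW hi (by simp [hW, hzi, hxi])
      simp [hzi, this]
    · exact le_trans (by have := min_le_left (z i) (d i); omega) hzi
  -- The demand of `W` goes unused because `z` vanishes there; this compensates for the excess of
  -- `S`.
  have hXout : ∑ i ∈ Sᶜ, min (z i) (d i) + ∑ i ∈ W, d i ≤ ∑ i ∈ Sᶜ, d i := by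
    rw [← Finset.sum_sdiff hWS, ← Finset.sum_sdiff (f := d) hWS]
    have h1 : ∑ i ∈ Sᶜ \ W, min (z i) (d i) ≤ ∑ i ∈ Sᶜ \ W, d i :=
      Finset.sum_le_sum fun i _ => min_le_right _ _
    have h2 : ∑ i ∈ W, min (z i) (d i) = 0 :=
      Finset.sum_eq_zero fun i hi => by simp [(Finset.mem_filter.1 hi).2.1]
    omega
  have e1 := Finset.sum_add_sum_compl S (fun i => min (z i) (d i))
  have e2 := Finset.sum_add_sum_compl S x
  have e3 : ∑ j ∈ Sᶜ, ((x + d) j : ℤ) =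
      ((∑ j ∈ Sᶜ, x j : ℕ) : ℤ) + ((∑ j ∈ Sᶜ, d j : ℕ) : ℤ) := by
    push_cast [Pi.add_apply]
    exact Finset.sum_add_distrib
  have e4 : ∑ i ∈ W, (d i : ℤ) = ((∑ i ∈ W, d i : ℕ) : ℤ) := by push_cast; rfl
  simp only [excess] at hSe
  rw [e3, e4] at hSe
  omega

/-! ### Clinching preserves the combinatorial invariants -/

/-- The combinatorial invariants of the market: the allocation is feasible, no buyer can clinch,
and every buyer who has clinched is confined by a set of small excess. -/
structure Market.IsClinched (f : Finset (Fin n) → ℕ) (m : Market n) : Prop where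
  feasible : ∀ S, ∑ i ∈ S, m.x i ≤ f S
  le_excess : ∀ i S, i ∉ S → (m.d i : ℤ) ≤ excess f (m.x + m.d) S
  tight : ∀ i, m.x i = 0 ∨ ∃ S, i ∉ S ∧ excess f (m.x + m.d) S ≤ m.d i

/-- The market after each buyer `i` has bought `δ i` units at the price `c`. -/
def Market.buy (m : Market n) (c : ℝ) (δ : Fin n → ℕ) : Market n where
  x := fun i => m.x i + δ i
  p := fun i => m.p i + c * δ i
  d := fun i => m.d i - δ i

theorem Market.buy_buy (m : Market n) (c : ℝ) (δ ε : Fin n → ℕ) :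
    (m.buy c δ).buy c ε = m.buy c (δ + ε) := by
  simp only [Market.buy, Pi.add_apply, Nat.cast_add, mul_add, add_assoc, Nat.sub_sub]

theorem clinchBuyer_eq_buy (c : ℝ) (m : Market n) (i : Fin n) :
    clinchBuyer f c m i = m.buy c (Pi.single i (clinchAmount f m.x m.d i)) := by
  simp only [clinchBuyer, Market.buy, Market.mk.injEq]
  refine ⟨?_, ?_, ?_⟩ <;>
  · funext j
    by_cases hj : j = i
    · subst hj
      simp
    · simp [hj]

theorem Market.excess_buy {m : Market n} {c : ℝ} {δ : Fin n → ℕ} (hδ : ∀ i, δ i ≤ m.d i) :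
    excess f ((m.buy c δ).x + (m.buy c δ).d) = excess f (m.x + m.d) := by
  congr 1
  funext i
  have := hδ i
  simp only [Market.buy, Pi.add_apply]
  omega

/-- Purchases keep `x + d`, hence every excess, so what one buyer achieves by clinching survives the
later turns and a single pass suffices. -/
theorem foldl_clinchBuyer (hf : IsMonotoneSubmodular f) (c : ℝ) (l : List (Fin n)) (m : Market n)
    (hx : ∀ S, ∑ i ∈ S, m.x i ≤ f S) (h0 : ∀ S, 0 ≤ excess f (m.x + m.d) S) :
    ∃ δ : Fin n → ℕ, (∀ i, δ i ≤ m.d i) ∧ l.foldl (clinchBuyer f c) m = m.buy c δ ∧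
      (∀ S, ∑ i ∈ S, (m.x i + δ i) ≤ f S) ∧
      (∀ i ∈ l, ∀ S, i ∉ S → ((m.d i - δ i : ℕ) : ℤ) ≤ excess f (m.x + m.d) S) ∧
      ∀ i, 0 < δ i → ∃ S, i ∉ S ∧ excess f (m.x + m.d) S ≤ (m.d i - δ i : ℕ) := by
  induction l generalizing m with
  | nil =>
    exact ⟨0, by simp, by simp [Market.buy], by simpa using hx, by simp, by simp⟩
  | cons a l ih =>
    set k := clinchAmount f m.x m.d a with hk
    set ε : Fin n → ℕ := Pi.single a k with hε
    have hεa : ε a = k := by simp [hε]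
    have hεne : ∀ i, i ≠ a → ε i = 0 := fun i hi => by simp [hε, hi]
    have hka : k ≤ m.d a := clinchAmount_le _ _ _
    have hεd : ∀ i, ε i ≤ m.d i := fun i => by
      by_cases hi : i = a
      · rw [hi, hεa]
        exact hka
      · rw [hεne i hi]
        exact Nat.zero_le _
    have hex := m.excess_buy (f := f) (c := c) hεd
    obtain ⟨δ, hδd, hfold, hfeas, hstrong, htight⟩ := ih (m.buy c ε) (fun S => by
        have h := sum_add_single_clinchAmount_le (f := f) (x := m.x) (d := m.d) (u := 0) (i := a)
          (by simp) (by simpa using hx) rfl S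
        simp only [Pi.zero_apply, add_zero] at h
        simp only [Market.buy, Finset.sum_add_distrib]
        rw [hε, Finset.sum_pi_single']
        exact h) (by rw [hex]; exact h0)
    rw [hex] at hstrong htight
    simp only [Market.buy] at hδd hfeas hstrong htight
    refine ⟨ε + δ, fun i => ?_, ?_, fun S => ?_, fun i hi S hS => ?_, fun i hi => ?_⟩
    · have h1 := hεd i
      have h2 := hδd i
      simp only [Pi.add_apply]
      omega
    · rw [List.foldl_cons, clinchBuyer_eq_buy, hfold, Market.buy_buy]
    · simpa only [Pi.add_apply, add_assoc] using hfeas S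
    · simp only [Pi.add_apply, ← Nat.sub_sub]
      rcases List.mem_cons.1 hi with rfl | hi
      · have h1 : ((m.d i - k : ℕ) : ℤ) ≤ excess f (m.x + m.d) S := by
          by_contra! hlt
          have h2 := le_clinchAmount hf h0 hS (d := m.d) (x := m.x)
            (w := (m.d i - excess f (m.x + m.d) S).toNat) (by have := h0 S; omega)
          rw [← hk] at h2
          have := h0 S
          omega
        rw [hεa]
        omega
      · exact hstrong i hi S hS
    · simp only [Pi.add_apply, ← Nat.sub_sub] at hi ⊢
      by_cases hδi : 0 < δ i
      · exact htight i hδi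
      · have hδ0 : δ i = 0 := by omega
        have hia : i = a := by
          by_contra hne
          rw [hεne i hne] at hi
          omega
        subst hia
        obtain ⟨T, hT, hTe⟩ := exists_excess_add_clinchAmount_le hf (d := m.d) hx
          (i := i) (by omega)
        exact ⟨T, hT, by omega⟩

/-- Lowering `d j` lowers both sides of the tightness of `j` equally, and for other buyers it can
only lower the excess. Excesses stay nonnegative because `d j` was at most the excess of each set
avoiding `j`. -/
theorem exists_clinching_eq_buy (hf : IsMonotoneSubmodular f) (c : ℝ) (m : Market n)
    (hm : m.IsClinched f) {j : Fin n} {k : ℕ} (hk : k ≤ m.d j) :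
    ∃ δ : Fin n → ℕ, (∀ i, δ i ≤ (m.setDemand j k).d i) ∧
      clinching f c (m.setDemand j k) = (m.setDemand j k).buy c δ ∧
      ((m.setDemand j k).buy c δ).IsClinched f := by
  have hne : ∀ S, j ∉ S → excess f ((m.setDemand j k).x + (m.setDemand j k).d) S =
      excess f (m.x + m.d) S - m.d j + k := fun S hS => excess_update_of_notMem m.x m.d hS
  have hmem : ∀ S, j ∈ S → excess f ((m.setDemand j k).x + (m.setDemand j k).d) S =
      excess f (m.x + m.d) S := fun S hS => excess_update_of_mem m.x m.d hS
  have hdj : (m.setDemand j k).d j = k := Function.update_self ..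
  have hdne : ∀ i, i ≠ j → (m.setDemand j k).d i = m.d i := fun i hi =>
    Function.update_of_ne hi ..
  have htight : ∀ i, m.x i = 0 ∨ ∃ S, i ∉ S ∧
      excess f ((m.setDemand j k).x + (m.setDemand j k).d) S ≤ (m.setDemand j k).d i := by
    intro i
    refine (hm.tight i).imp_right fun ⟨S, hS, hSe⟩ => ⟨S, hS, ?_⟩
    by_cases hi : i = j
    · subst hi
      rw [hne S hS, hdj]
      omega
    · rw [hdne i hi]
      by_cases hj : j ∈ S
      · rw [hmem S hj]
        exact hSe
      · rw [hne S hj]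
        omega
  have h0 : ∀ S, 0 ≤ excess f ((m.setDemand j k).x + (m.setDemand j k).d) S := by
    intro S
    by_cases hj : j ∈ S
    · rw [hmem S hj]
      exact excess_nonneg hm.le_excess S
    · rw [hne S hj]
      have := hm.le_excess j S hj
      omega
  obtain ⟨δ, hδ, heq, hfeas, hstrong, hti⟩ :=
    foldl_clinchBuyer hf c (List.finRange n) (m.setDemand j k) hm.feasible h0
  refine ⟨δ, hδ, heq, hfeas, ?_, ?_⟩
  · rw [Market.excess_buy hδ]
    exact fun i S hS => hstrong i (List.mem_finRange i) S hS
  · rw [Market.excess_buy hδ]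
    intro i
    by_cases hi : 0 < δ i
    · exact Or.inr (hti i hi)
    · have hi0 : δ i = 0 := by omega
      simp only [Market.buy, hi0, Nat.add_zero, Nat.sub_zero]
      exact htight i

/-! ### Affordability -/

/-- Prices, budgets and payments are consistent: active buyers still bid at least the price, the
demands are affordable, and no buyer has overpaid. -/
structure Market.IsAffordable (v B : Fin n → ℝ) (m : Market n) (c : ℝ) : Prop where
  price_nonneg : 0 ≤ c
  price_le : ∀ i, m.Active i → c ≤ v i
  demand_le : ∀ i, c * m.d i ≤ B i - m.p i
  payment_lt : ∀ i, m.Active i → m.p i < B i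
  payment_le : ∀ i, m.p i ≤ v i * m.x i

theorem Market.IsAffordable.setDemand {v B : Fin n → ℝ} {m : Market n} {c : ℝ}
    (hm : m.IsAffordable v B c) {j : Fin n} {k : ℕ} (hk : k ≤ m.d j) :
    (m.setDemand j k).IsAffordable v B c := by
  have hle : ∀ i, (m.setDemand j k).d i ≤ m.d i := fun i => by
    simp only [Market.setDemand]
    by_cases hi : i = j
    · subst hi
      simpa using hk
    · rw [Function.update_of_ne hi]
  exact ⟨hm.price_nonneg, fun i hi => hm.price_le i (lt_of_lt_of_le hi (hle i)),
    fun i => (mul_le_mul_of_nonneg_left (Nat.cast_le.2 (hle i)) hm.price_nonneg).trans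
      (hm.demand_le i), fun i hi => hm.payment_lt i (lt_of_lt_of_le hi (hle i)), hm.payment_le⟩

theorem Market.IsAffordable.buy {v B : Fin n → ℝ} {m : Market n} {c : ℝ}
    (hm : m.IsAffordable v B c) {δ : Fin n → ℕ} (hδ : ∀ i, δ i ≤ m.d i) :
    (m.buy c δ).IsAffordable v B c := by
  have hdemand : ∀ i, c * ((m.d i - δ i : ℕ) : ℝ) ≤ B i - (m.p i + c * δ i) := fun i => by
    have := hm.demand_le i
    rw [Nat.cast_sub (hδ i)]
    linarith
  refine ⟨hm.price_nonneg, fun i hi => hm.price_le i ?_, hdemand, fun i hi => ?_, fun i => ?_⟩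
  · exact lt_of_lt_of_le hi (Nat.sub_le _ _)
  · rcases hm.price_nonneg.eq_or_lt with hc | hc
    · simpa [Market.buy, ← hc] using hm.payment_lt i (lt_of_lt_of_le hi (Nat.sub_le _ _))
    · have h1 := hdemand i
      have h2 : 0 < c * ((m.d i - δ i : ℕ) : ℝ) := mul_pos hc (Nat.cast_pos.2 hi)
      simp only [Market.buy]
      linarith
  · have h1 := hm.payment_le i
    simp only [Market.buy, Nat.cast_add]
    rcases Nat.eq_zero_or_pos (δ i) with h0 | hpos
    · simpa [h0] using h1
    · have h2 := hm.price_le i (lt_of_lt_of_le hpos (hδ i))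
      have h3 := mul_le_mul_of_nonneg_right h2 (Nat.cast_nonneg (α := ℝ) (δ i))
      linarith

/-- A bid passed, or a demand made unaffordable, on the way to `t` would have given a smaller
critical price. -/
theorem Market.IsAffordable.raisePrice {v B : Fin n → ℝ} {m : Market n} {c t : ℝ}
    (hm : m.IsAffordable v B c)
    (ht : IsLeast {t : ℝ | c ≤ t ∧ t ∈ criticalPrices v B m} t) :
    m.IsAffordable v B t := by
  refine ⟨hm.price_nonneg.trans ht.1.1, fun i hi => ?_, fun i => ?_, hm.payment_lt, hm.payment_le⟩
  · exact ht.2 ⟨hm.price_le i hi, i, hi, Or.inl rfl⟩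
  · have h1 := hm.demand_le i
    rcases Nat.eq_zero_or_pos (m.d i) with h0 | hpos
    · have h2 := h1
      rw [h0, Nat.cast_zero, mul_zero] at h2 ⊢
      exact h2
    · have hpos' : (0 : ℝ) < m.d i := Nat.cast_pos.2 hpos
      -- Strictness makes the price `(B i - m.p i) / m.d i` nonzero, so dividing by it is
      -- legitimate.
      have hB : 0 < B i - m.p i := sub_pos.2 (hm.payment_lt i hpos)
      by_contra! hlt
      refine absurd (ht.2 ⟨(le_div_iff₀ hpos').2 h1, i, hpos, Or.inr ?_⟩)
        (not_le.2 ((div_lt_iff₀ hpos').2 hlt))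
      field_simp

/-! ### The credit of a single buyer -/

/-- For a buyer with valuation `v`, budget `b` and singleton supply `k`, allocation `x`, payment `p`
and demand `d` at the price `c`, the number `g` keeps up with the gain in liquid welfare from `z`
further units. -/
structure GainBound (k z x d : ℕ) (v b c p g : ℝ) : Prop where
  accrued : c * (min z d : ℕ) ≤ g
  of_active : 0 < d → x + d = k + 1 ∨ (b - p ≤ c * (d + 1) ∧ (d < z → b - p ≤ g))
  of_inactive : d = 0 → z + x ≤ k → min (v * z) (b - p) ≤ g

namespace GainBound

variable {k z x d : ℕ} {v b c p g : ℝ}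

theorem raisePrice (h : GainBound k z x d v b c p g) {t : ℝ} (ht : c ≤ t) :
    GainBound k z x d v b t p (g + (t - c) * (min z d : ℕ)) := by
  have hg : g ≤ g + (t - c) * (min z d : ℕ) :=
    le_add_of_nonneg_right (mul_nonneg (sub_nonneg.2 ht) (Nat.cast_nonneg _))
  refine ⟨?_, fun hd => (h.of_active hd).imp_right fun ⟨h1, h2⟩ => ⟨?_, fun hz => ?_⟩,
    fun hd hz => (h.of_inactive hd hz).trans hg⟩
  · have := h.accrued
    linarith
  · exact h1.trans (mul_le_mul_of_nonneg_right ht (by positivity))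
  · exact (h2 hz).trans hg

theorem accrued_le (h : GainBound k z x d v b c p g) (hc : 0 ≤ c) {w : ℕ} (hz : w ≤ z)
    (hd : w ≤ d) : c * w ≤ g :=
  (mul_le_mul_of_nonneg_left (Nat.cast_le.2 (le_min hz hd)) hc).trans h.accrued

theorem of_limited (h : GainBound k z x d v b c p g) (hc : 0 ≤ c) {x' d' : ℕ} {p' : ℝ}
    (hd' : d' ≤ d) (h1 : b - p' ≤ c * (d' + 1)) (h2 : d' < z → b - p' ≤ g) :
    GainBound k z x' d' v b c p' g := by
  refine ⟨h.accrued_le hc (min_le_left _ _) ((min_le_right _ _).trans hd'),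
    fun _ => Or.inr ⟨h1, h2⟩, fun hd _ => ?_⟩
  rcases Nat.eq_zero_or_pos z with hz | hz
  · have h0 := h.accrued_le hc (Nat.zero_le z) (Nat.zero_le d)
    refine (min_le_left _ _).trans ?_
    simpa [hz] using h0
  · exact (min_le_right _ _).trans (h2 (by omega))

theorem buy (h : GainBound k z x d v b c p g) (hc : 0 ≤ c) {δ : ℕ} (hδ : δ ≤ d)
    (hx : x + δ ≤ k) : GainBound k z (x + δ) (d - δ) v b c (p + c * δ) g := by
  rcases Nat.eq_zero_or_pos d with hd | hd
  · obtain rfl : δ = 0 := by omega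
    simpa using h
  · rcases h.of_active hd with hfree | ⟨h1, h2⟩
    -- Thanks to the extra unit of initial demand, `x + δ ≤ k` leaves demand at least one, so such a
    -- buyer cannot become inactive by clinching.
    · exact ⟨h.accrued_le hc (min_le_left _ _) ((min_le_right _ _).trans (Nat.sub_le _ _)),
        fun _ => Or.inl (by omega), fun _ => by omega⟩
    · have h1' : b - (p + c * δ) ≤ c * ((d - δ : ℕ) + 1) := by
        rw [Nat.cast_sub hδ]
        linarith
      refine h.of_limited hc (Nat.sub_le _ _) h1' fun hz => ?_
      by_cases hdz : d < z
      · have := h2 hdz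
        have : 0 ≤ c * δ := by positivity
        linarith
      · rcases Nat.eq_zero_or_pos δ with h0 | hpos
        · omega
        · refine h1'.trans ?_
          -- This purchase takes the demand from at least `z` to below `z`, so `d - δ + 1` units
          -- still counted towards the credit.
          have := h.accrued_le hc (w := d - δ + 1) (by omega) (by omega)
          exact_mod_cast this

/-- If the new demand is below `z`, then `d ≤ z`, and the credit of at least `c * d` is the whole
remaining budget. -/
theorem reduceDemand (h : GainBound k z x d v b c p g) (hc : 0 ≤ c) (hd : 0 < d)
    (heq : c * d = b - p) : GainBound k z x (d - 1) v b c p g := by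
  have hcast : ((d - 1 : ℕ) : ℝ) + 1 = d := by
    rw [Nat.cast_sub hd]
    simp
  refine h.of_limited hc (Nat.sub_le _ _) (by rw [hcast, heq]) fun hz => ?_
  rw [← heq]
  exact h.accrued_le hc (by omega) le_rfl

theorem dropBid (h : GainBound k z x d v b c p g) (hc : 0 ≤ c) (hd : 0 < d)
    (heq : v = c) : GainBound k z x 0 v b c p g := by
  refine ⟨h.accrued_le hc (min_le_left _ _) ((min_le_right _ _).trans (Nat.zero_le _)),
    fun h0 => absurd h0 (lt_irrefl 0), fun _ hz => ?_⟩
  by_cases hzd : z ≤ d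
  · exact (min_le_left _ _).trans (heq ▸ h.accrued_le hc le_rfl hzd)
  · rcases h.of_active hd with hfree | ⟨_, h2⟩
    · omega
    · exact (min_le_right _ _).trans (h2 (by omega))

end GainBound

/-! ### The invariants along an execution -/

/-- The numbers `G i` bound the gains from `z i` further units, and they are covered by the payments
and the value of the remaining supply at the current price. -/
structure Market.HasGainBounds (f : Finset (Fin n) → ℕ) (v B : Fin n → ℝ) (z : Fin n → ℕ)
    (m : Market n) (c : ℝ) (G : Fin n → ℝ) : Prop where
  bound : ∀ i, GainBound (f {i}) (z i) (m.x i) (m.d i) (v i) (B i) c (m.p i) (G i)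
  sum_le : ∑ i, G i ≤ ∑ i, m.p i + c * (f Finset.univ - ∑ i, (m.x i : ℝ))

/-- The invariants of the auction. Here `y` is an allocation to compare with, and `z` a part of it
that lies above the allocation of the auction. -/
structure Market.Invariant (f : Finset (Fin n) → ℕ) (v B : Fin n → ℝ) (y z : Fin n → ℕ)
    (m : Market n) (c : ℝ) : Prop where
  clinched : m.IsClinched f
  affordable : m.IsAffordable v B c
  gain : (∀ i, z i = 0 ∨ m.x i + z i ≤ y i) → ∃ G, m.HasGainBounds f v B z c G

variable {v B : Fin n → ℝ} {y z : Fin n → ℕ}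

theorem invariant_initial (hf : IsMonotoneSubmodular f)
    (hcomp : ∀ i, f Finset.univ = f (Finset.univ.erase i)) (hv : ∀ i, 0 < v i)
    (hB : ∀ i, 0 < B i) : (initial f).toMarket.Invariant f v B y z 0 := by
  refine ⟨⟨?_, ?_, ?_⟩, ⟨le_rfl, ?_, ?_, ?_, ?_⟩, fun _ => ⟨0, ?_, ?_⟩⟩
  · simp [initial]
  · intro i S hi
    have hi' : i ∈ Sᶜ := by simpa using hi
    -- As `f(N) = f(N \ i)`, the other buyers can absorb the whole supply, so the demand `f {i} + 1`
    -- of `i` is all excess.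
    have h1 := hf.union_le_add_sum S (Sᶜ.erase i)
    have h2 : S ∪ Sᶜ.erase i = Finset.univ.erase i := by
      ext j
      simp only [Finset.mem_union, Finset.mem_erase, Finset.mem_compl, Finset.mem_univ, and_true]
      constructor
      · rintro (h | h)
        · rintro rfl
          exact hi h
        · exact h.1
      · intro h
        tauto
    rw [h2, ← hcomp i] at h1
    have h3 := Finset.add_sum_erase Sᶜ (fun j => f {j} + 1) hi'
    have h4 : ∑ j ∈ Sᶜ.erase i, f {j} ≤ ∑ j ∈ Sᶜ.erase i, (f {j} + 1) :=
      Finset.sum_le_sum fun _ _ => Nat.le_succ _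
    have h5 : ∑ j ∈ Sᶜ, (((initial f).x + (initial f).d) j : ℤ) =
        ((∑ j ∈ Sᶜ, (f {j} + 1) : ℕ) : ℤ) := by
      simp [initial]
    simp only [excess]
    rw [h5]
    simp only [initial]
    omega
  · exact fun i => Or.inl rfl
  · exact fun i _ => (hv i).le
  · intro i
    simpa [initial] using (hB i).le
  · intro i _
    simpa [initial] using hB i
  · simp [initial]
  · intro i
    refine ⟨by simp, fun _ => Or.inl (by simp [initial]), fun h => ?_⟩
    simp [initial] at h
  · simp [initial]

theorem Market.Invariant.raisePrice (hf : IsMonotoneSubmodular f) {m : Market n} {c t : ℝ}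
    (hy : ∀ S, ∑ i ∈ S, y i ≤ f S) (hm : m.Invariant f v B y z c)
    (ht : IsLeast {t : ℝ | c ≤ t ∧ t ∈ criticalPrices v B m} t) : m.Invariant f v B y z t := by
  refine ⟨hm.clinched, hm.affordable.raisePrice ht, fun hz => ?_⟩
  obtain ⟨G, hG, hsum⟩ := hm.gain hz
  refine ⟨_, fun i => (hG i).raisePrice ht.1.1, ?_⟩
  have hkey := sum_min_le_supply hf (excess_nonneg hm.clinched.le_excess) hm.clinched.tight hy hz
  have hkey' : (∑ i, ((min (z i) (m.d i) : ℕ) : ℝ)) + ∑ i, (m.x i : ℝ) ≤ f Finset.univ := by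
    exact_mod_cast hkey
  rw [Finset.sum_add_distrib, ← Finset.mul_sum]
  have := mul_le_mul_of_nonneg_left (le_sub_iff_add_le.2 hkey') (sub_nonneg.2 ht.1.1)
  linarith

theorem Market.Invariant.clinching (hf : IsMonotoneSubmodular f) {m : Market n} {c : ℝ}
    (hm : m.Invariant f v B y z c) {j : Fin n} {k : ℕ} (hk : k ≤ m.d j)
    (hj : ∀ g, GainBound (f {j}) (z j) (m.x j) (m.d j) (v j) (B j) c (m.p j) g →
      GainBound (f {j}) (z j) (m.x j) k (v j) (B j) c (m.p j) g) :
    (clinching f c (m.setDemand j k)).Invariant f v B y z c := by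
  obtain ⟨δ, hδ, heq, hcl⟩ := exists_clinching_eq_buy hf c m hm.clinched hk
  rw [heq]
  refine ⟨hcl, (hm.affordable.setDemand hk).buy hδ, fun hz => ?_⟩
  -- Allocations only grow, so the condition on `z` passes from the later market back to the earlier
  -- one; this allows `z` to be defined from the final allocation.
  obtain ⟨G, hG, hsum⟩ := hm.gain fun i => (hz i).imp_right fun h => by
    simp only [Market.buy, Market.setDemand] at h
    omega
  refine ⟨G, fun i => GainBound.buy ?_ hm.affordable.price_nonneg (hδ i) ?_, ?_⟩
  · by_cases hi : i = j
    · subst hi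
      simpa [Market.setDemand] using hj _ (hG i)
    · simpa [Market.setDemand, Function.update_of_ne hi] using hG i
  · have := hcl.feasible {i}
    rwa [Finset.sum_singleton] at this
  · simp only [Market.buy, Market.setDemand, Nat.cast_add, Finset.sum_add_distrib,
      ← Finset.mul_sum]
    linarith

theorem Step.invariant (hf : IsMonotoneSubmodular f) (hy : ∀ S, ∑ i ∈ S, y i ≤ f S)
    {s s' : State n} (h : Step f v B s s') (hs : s.toMarket.Invariant f v B y z s.c) :
    s'.toMarket.Invariant f v B y z s'.c := by
  cases h with
  | raisePrice m c t hact ht => exact hs.raisePrice hf hy ht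
  | dropBid m c j hact hj =>
    exact hs.clinching hf (Nat.zero_le _) fun g hg =>
      hg.dropBid hs.affordable.price_nonneg hact hj
  | endBids m c hno => exact hs
  | reduceDemand m c j hact hj =>
    refine hs.clinching hf (Nat.sub_le _ _) fun g hg =>
      hg.reduceDemand hs.affordable.price_nonneg hact ?_
    have hd : (m.d j : ℝ) ≠ 0 := Nat.cast_ne_zero.2 (ne_of_gt hact)
    have hc : c ≠ 0 := by
      rintro rfl
      rw [div_zero] at hj
      exact hd hj
    rw [hj]
    field_simp
  | endBudgets m c hno => exact hs

theorem Reachable.invariant (hf : IsMonotoneSubmodular f)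
    (hcomp : ∀ i, f Finset.univ = f (Finset.univ.erase i)) (hv : ∀ i, 0 < v i)
    (hB : ∀ i, 0 < B i) (hy : ∀ S, ∑ i ∈ S, y i ≤ f S) {s : State n}
    (h : Reachable f v B s) : s.toMarket.Invariant f v B y z s.c := by
  induction h with
  | refl => exact invariant_initial hf hcomp hv hB
  | tail _ hstep ih => exact hstep.invariant hf hy ih

/-! ### Termination -/

theorem d_clinching_le (c : ℝ) (m : Market n) (i : Fin n) : (clinching f c m).d i ≤ m.d i := by
  unfold clinching
  induction List.finRange n generalizing m with
  | nil => exact le_rfl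
  | cons a l ih =>
    rw [List.foldl_cons, clinchBuyer_eq_buy]
    exact (ih _).trans (Nat.sub_le _ _)

theorem sum_d_clinching_lt (c : ℝ) (m : Market n) {j : Fin n} {k : ℕ} (hk : k < m.d j) :
    ∑ i, (clinching f c (m.setDemand j k)).d i < ∑ i, m.d i := by
  refine (Finset.sum_le_sum fun i _ => d_clinching_le c _ i).trans_lt
    (Finset.sum_lt_sum (fun i _ => ?_) ⟨j, Finset.mem_univ j, by simpa [Market.setDemand] using hk⟩)
  by_cases hi : i = j
  · subst hi
    simpa [Market.setDemand] using hk.le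
  · simp [Market.setDemand, Function.update_of_ne hi]

open scoped Classical in
/-- The part of the termination measure that depends on the phase. -/
noncomputable def phaseRank (v B : Fin n → ℝ) (s : State n) : ℕ :=
  match s.phase with
  | Phase.outer => 2
  | Phase.bids => if s.c ∈ criticalPrices v B s.toMarket then 1 else 4
  | Phase.budgets => if ∃ j, s.Active j ∧ (s.d j : ℝ) = (B j - s.p j) / s.c then 0 else 3

theorem phaseRank_le (s : State n) : phaseRank v B s ≤ 4 := by
  unfold phaseRank
  split
  · norm_num
  · split_ifs <;> norm_num
  · split_ifs <;> norm_num

/-- A demand step lowers the total demand, and the factor 5 outweighs any change of rank. The other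
steps lower the rank: a price rise lands on a critical price, so the two inner loops cannot both
pass without a demand step. -/
theorem Step.measure_lt {s s' : State n} (h : Step f v B s s') :
    5 * ∑ i, s'.d i + phaseRank v B s' < 5 * ∑ i, s.d i + phaseRank v B s := by
  cases h with
  | raisePrice m c t hact ht =>
    simp [phaseRank, ht.1.2]
  | dropBid m c j hact hj =>
    have h1 := sum_d_clinching_lt (f := f) c m (k := 0) hact
    have h2 := phaseRank_le (v := v) (B := B)
      ⟨ClinchingAuction.clinching f c (m.setDemand j 0), c, Phase.bids⟩
    dsimp only at h1 h2 ⊢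
    omega
  | endBids m c hno =>
    have hiff : c ∈ criticalPrices v B m ↔
        ∃ j, m.Active j ∧ (m.d j : ℝ) = (B j - m.p j) / c := by
      refine exists_congr fun j => and_congr_right fun hj => or_iff_right fun h => ?_
      exact hno ⟨j, hj, h⟩
    by_cases h : ∃ j, m.Active j ∧ (m.d j : ℝ) = (B j - m.p j) / c
    · simp [phaseRank, hiff.2 h, h]
    · simp [phaseRank, mt hiff.1 h, h]
  | reduceDemand m c j hact hj =>
    have h1 := sum_d_clinching_lt (f := f) c m (Nat.sub_lt hact one_pos)
    have h2 := phaseRank_le (v := v) (B := B)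
      ⟨ClinchingAuction.clinching f c (m.setDemand j (m.d j - 1)), c, Phase.budgets⟩
    dsimp only at h1 h2 ⊢
    omega
  | endBudgets m c hno =>
    simp [phaseRank, hno]

/-- Critical prices are bids or quotients of remaining budget by demand, hence finitely many, and
the bid of an active buyer is one not below `c`. -/
theorem exists_isLeast_criticalPrices {m : Market n} {c : ℝ} (hact : ∃ i, m.Active i)
    (hm : m.IsAffordable v B c) :
    ∃ t, IsLeast {t : ℝ | c ≤ t ∧ t ∈ criticalPrices v B m} t := by
  obtain ⟨i, hi⟩ := hact
  have hfin : {t : ℝ | c ≤ t ∧ t ∈ criticalPrices v B m}.Finite := by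
    refine ((Set.finite_range v).union
      (Set.finite_range fun j => (B j - m.p j) / (m.d j : ℝ))).subset ?_
    rintro t ⟨-, j, hj, rfl | h⟩
    · exact Or.inl ⟨j, rfl⟩
    · refine Or.inr ⟨j, ?_⟩
      have hd : (m.d j : ℝ) ≠ 0 := Nat.cast_ne_zero.2 (ne_of_gt hj)
      have hB : B j - m.p j ≠ 0 := fun h0 => hd (by rw [h, h0, zero_div])
      dsimp only
      rw [h, div_div_cancel₀ hB]
  obtain ⟨t, ht, hmin⟩ := Set.exists_min_image _ id hfin
    ⟨v i, hm.price_le i hi, i, hi, Or.inl rfl⟩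
  exact ⟨t, ht, fun u hu => hmin u hu⟩

theorem terminates (hf : IsMonotoneSubmodular f)
    (hcomp : ∀ i, f Finset.univ = f (Finset.univ.erase i)) (hv : ∀ i, 0 < v i)
    (hB : ∀ i, 0 < B i) : Terminates f v B := by
  refine ⟨?_, fun s hs hstuck => ?_⟩
  · rintro ⟨run, -, hrun⟩
    exact not_strictAnti_of_wellFoundedLT
      (fun k => 5 * ∑ i, (run k).d i + phaseRank v B (run k))
      (strictAnti_nat_of_succ_lt fun k => (hrun k).measure_lt)
  · have hinv := hs.invariant (y := 0) (z := 0) hf hcomp hv hB (by simp)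
    obtain ⟨m, c, ph⟩ := s
    cases ph with
    | outer =>
      refine ⟨rfl, fun i hi => ?_⟩
      obtain ⟨t, ht⟩ := exists_isLeast_criticalPrices ⟨i, hi⟩ hinv.affordable
      exact hstuck _ (Step.raisePrice m c t ⟨i, hi⟩ ht)
    | bids =>
      by_cases h : ∃ j, m.Active j ∧ v j = c
      · obtain ⟨j, hj, hjc⟩ := h
        exact absurd (Step.dropBid m c j hj hjc) (hstuck _)
      · exact absurd (Step.endBids m c h) (hstuck _)
    | budgets =>
      by_cases h : ∃ j, m.Active j ∧ (m.d j : ℝ) = (B j - m.p j) / c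
      · obtain ⟨j, hj, hjc⟩ := h
        exact absurd (Step.reduceDemand m c j hj hjc) (hstuck _)
      · exact absurd (Step.endBudgets m c h) (hstuck _)

/-! ### Payments and liquid welfare of the output -/

theorem sum_payment_le_liquidWelfare {m : Market n} {c : ℝ} (hm : m.IsAffordable v B c) :
    ∑ i, m.p i ≤ liquidWelfare v B m.x := by
  refine Finset.sum_le_sum fun i _ => le_min (hm.payment_le i) ?_
  have h1 := hm.demand_le i
  have h2 : 0 ≤ c * (m.d i : ℝ) := mul_nonneg hm.price_nonneg (Nat.cast_nonneg _)
  linarith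

theorem liquidWelfare_sub_le_sum_payment (hf : IsMonotoneSubmodular f) {s : State n} (hs : s.Final)
    (hy : ∀ S, ∑ i ∈ S, y i ≤ f S) (hv : ∀ i, 0 < v i)
    (hinv : s.toMarket.Invariant f v B y (fun i => y i - s.x i) s.c) :
    liquidWelfare v B y - liquidWelfare v B s.x ≤ ∑ i, s.p i := by
  have hd : ∀ i, s.d i = 0 := fun i => Nat.eq_zero_of_not_pos (hs.2 i)
  obtain ⟨G, hG, hsum⟩ := hinv.gain fun i => by omega
  -- With no demand left, the nonnegative excess of the empty set says that the whole supply is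
  -- sold.
  have hsold : (f Finset.univ : ℝ) ≤ ∑ i, (s.x i : ℝ) := by
    have h := excess_nonneg hinv.clinched.le_excess ∅
    have hxd : s.x + s.d = s.x := by
      funext i
      simp [hd i]
    simp only [excess, hxd, hf.empty, Finset.compl_empty, Nat.cast_zero, zero_add, sub_nonneg] at h
    exact_mod_cast h
  have hgain : ∀ i, min (v i * y i) (B i) - min (v i * s.x i) (B i) ≤ G i := by
    intro i
    have hpi : s.p i ≤ min (v i * s.x i) (B i) := by
      refine le_min (hinv.affordable.payment_le i) ?_
      have h1 := hinv.affordable.demand_le i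
      rw [hd i] at h1
      simp only [Nat.cast_zero, mul_zero] at h1
      linarith
    have h0 : 0 ≤ G i := by
      have := (hG i).accrued
      rw [hd i] at this
      simpa using this
    rcases le_total (y i) (s.x i) with hle | hle
    · have : v i * (y i : ℝ) ≤ v i * s.x i :=
        mul_le_mul_of_nonneg_left (Nat.cast_le.2 hle) (hv i).le
      have := min_le_min_right (B i) this
      linarith
    · have hyi : y i ≤ f {i} := by simpa using hy {i}
      refine le_trans ?_ ((hG i).of_inactive (hd i) (by omega))
      rw [Nat.cast_sub hle]
      refine le_min ?_ ?_
      · rcases le_total (v i * (s.x i : ℝ)) (B i) with h | h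
        · rw [min_eq_left h]
          have := min_le_left (v i * (y i : ℝ)) (B i)
          linarith
        · rw [min_eq_right h]
          have h1 := min_le_right (v i * (y i : ℝ)) (B i)
          have h2 : 0 ≤ v i * ((y i : ℝ) - s.x i) :=
            mul_nonneg (hv i).le (sub_nonneg.2 (Nat.cast_le.2 hle))
          linarith
      · have := min_le_right (v i * (y i : ℝ)) (B i)
        linarith
  have hsum' := Finset.sum_le_sum fun i (_ : i ∈ Finset.univ) => hgain i
  rw [Finset.sum_sub_distrib] at hsum'
  have hrest := mul_nonpos_of_nonneg_of_nonpos hinv.affordable.price_nonneg (sub_nonpos.2 hsold)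
  unfold liquidWelfare
  linarith

end ClinchingAuction

theorem theorem5p3 {n : ℕ} (f : Finset (Fin n) → ℕ)
    (hf : ClinchingAuction.IsMonotoneSubmodular f)
    (hcomp : ∀ i : Fin n, f Finset.univ = f (Finset.univ.erase i))
    (v B : Fin n → ℝ) (hv : ∀ i, 0 < v i) (hB : ∀ i, 0 < B i) :
    ClinchingAuction.Terminates f v B ∧
    ∀ (x : Fin n → ℕ) (p : Fin n → ℝ), ClinchingAuction.IsOutcome f v B x p →
      (∑ i, p i ≤ ClinchingAuction.liquidWelfare v B x ∧
        ClinchingAuction.optLiquidWelfare f v B - ClinchingAuction.liquidWelfare v B x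
          ≤ ∑ i, p i) ∧
      1 / 2 * ClinchingAuction.optLiquidWelfare f v B ≤ ClinchingAuction.liquidWelfare v B x := by
  refine ⟨ClinchingAuction.terminates hf hcomp hv hB, ?_⟩
  rintro x p ⟨s, hs, hfinal, rfl, rfl⟩
  obtain ⟨y, hy, hopt⟩ := (ClinchingAuction.isGreatest_optLiquidWelfare f v B).1
  have hy' : ∀ S, ∑ i ∈ S, y i ≤ f S := fun S => by
    have := hy.2 S
    dsimp only at this
    exact_mod_cast this
  have hinv := hs.invariant (y := y) (z := fun i => y i - s.x i) hf hcomp hv hB hy'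
  have h1 := ClinchingAuction.sum_payment_le_liquidWelfare hinv.affordable
  have h2 := ClinchingAuction.liquidWelfare_sub_le_sum_payment hf hfinal hy' hv hinv
  rw [hopt] at h2
  exact ⟨⟨h1, h2⟩, by linarith⟩
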